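/- Let $n\ge 2$ and let $C\subset\mathbb R^n$ be a closed convex cone with nonempty interior that contains no line. Put $C^\circ=\{y\in\mathbb R^n:\langle x,y\rangle\le 0\text{ for all }x\in C\}$ and $\Omega=\operatorname{int}C^\circ\cap S^{n-1}$. Fix an orthonormal basis $e_1,\dots,e_n$ of $\mathbb R^n$ such that $u_*=-e_1\in\operatorname{int}C$ and, for some $\xi>0$, $\langle u,u_*\rangle>\xi$ for all $u\in C\cap S^{n-1}$ and $\langle v,u_*\rangle<-\xi$ for all $v\in C^\circ\cap S^{n-1}$. Write points of $\mathbb R^n$ as $(t,x)\in\mathbb R\times\mathbb R^{n-1}$ in these coordinates and let $\Phi:\mathbb R^{n-1}\to\{v\in S^{n-1}:\langle v,e_1\rangle>0\}$, $\Phi(x)=(1,x)/\sqrt{1+|x|^2}$, a bijection with inverse $\Phi^{-1}(v)=\langle v,e_1\rangle^{-1}(\langle v,e_2\rangle,\dots,\langle v,e_n\rangle)$. Here $\mathcal H^{n-1}$ is the $(n-1)$-dimensional Hausdorff measure, normalised to agree with Lebesgue measure on $\mathbb R^{n-1}$. Let $\mu$ be a locally finite Borel measure on $\Omega$, and for Borel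 $\Xi\subset\Phi^{-1}(\Omega)$ let $$\widetilde\mu(\Xi)=\int_{\Phi(\Xi)}|\langle v,e_1\rangle|\,d\mu(v).$$ Let $u:\overline{\Phi^{-1}(\Omega)}\to\mathbb R$ be continuous and convex, with $u=0$ on $\partial(\Phi^{-1}(\Omega))$ and $\mathcal M_u=\widetilde\mu$ on $\Phi^{-1}(\Omega)$, where $\mathcal M_u$ is the Monge–Ampère measure: for Borel $\Xi\subset\Phi^{-1}(\Omega)$, $$\mathcal M_u(\Xi)=\mathcal H^{n-1}\Big(\bigcup_{x\in\Xi}\partial u(x)\Big),\qquad \partial u(x)=\{p\in\mathbb R^{n-1}: u(z)\ge u(x)+\langle p,z-x\rangle\ \text{for all } z\in\Phi^{-1}(\Omega)\}.$$ Define $$K=\bigcap_{v\in\overline\Omega}\{z\in\mathbb R^n:\langle z,v\rangle\le\langle v,e_1\rangle\,u(\Phi^{-1}(v))\}.$$ Then $K$ is $C$-asymptotic, that is: - $K$ is nonempty, closed and convex, and $\lambda x\in K$ for all $x\in K$ and $\lambda\ge1$; - its recession cone $\{y\in\mathbb R^n: x+\lambda y\in K\text{ for all }x\in K,\ \lambda\ge1\}$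 equals $C$; - $\operatorname{dist}(x,\partial C)\to0$ as $|x|\to\infty$ with $x\in\partial K$. Moreover $S_K=\mu$ on $\Omega$, where, for every Borel $\eta\subset\Omega$, $$S_K(\eta)=\mathcal H^{n-1}\big(\{x\in\partial K:\langle x,v\rangle=h_K(v)\text{ for some }v\in\eta\}\big),\qquad h_K(v)=\sup_{x\in K}\langle x,v\rangle .$$ -/

import Mathlib

open Set Filter Topology MeasureTheory
open scoped RealInnerProductSpace ENNReal

noncomputable section

namespace PseudoCone

/-- Euclidean space `ℝ^d`. -/
abbrev Euc (d : ℕ) : Type := EuclideanSpace ℝ (Fin d)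

/-! ### Cones, duals and pseudo cones -/

/-- A closed convex cone with nonempty interior which is pointed, i.e. contains no full line. -/
structure IsSolidPointedCone {d : ℕ} (C : Set (Euc d)) : Prop where
  smul_mem : ∀ x ∈ C, ∀ r : ℝ, 0 ≤ r → r • x ∈ C
  isClosed : IsClosed C
  convex : Convex ℝ C
  interior_nonempty : (interior C).Nonempty
  no_line : ¬ ∃ x w : Euc d, w ≠ 0 ∧ ∀ t : ℝ, x + t • w ∈ C

/-- The dual (polar) cone `C° = {y : ⟨x, y⟩ ≤ 0 for all x ∈ C}`. -/
def dualCone {d : ℕ} (C : Set (Euc d)) : Set (Euc d) :=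
  {y | ∀ x ∈ C, ⟪x, y⟫ ≤ 0}

/-- `Ω = int C° ∩ S^{d-1}`. -/
def Omega {d : ℕ} (C : Set (Euc d)) : Set (Euc d) :=
  interior (dualCone C) ∩ Metric.sphere 0 1

/-- A nonempty closed convex set `K` with `λ K ⊆ K` for all `λ ≥ 1`. -/
structure IsPseudoCone {d : ℕ} (K : Set (Euc d)) : Prop where
  nonempty : K.Nonempty
  isClosed : IsClosed K
  convex : Convex ℝ K
  smul_mem : ∀ x ∈ K, ∀ r : ℝ, 1 ≤ r → r • x ∈ K

/-- The recession cone of `K`. -/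
def recCone {d : ℕ} (K : Set (Euc d)) : Set (Euc d) :=
  {y | ∀ x ∈ K, ∀ r : ℝ, 1 ≤ r → x + r • y ∈ K}

/-- `K` is `C`-pseudo: a pseudo cone whose recession cone is `C`. -/
def IsCPseudo {d : ℕ} (C K : Set (Euc d)) : Prop :=
  IsPseudoCone K ∧ recCone K = C

/-- `K` is `C`-asymptotic: it is `C`-pseudo, and `dist (x, ∂C) → 0` as `|x| → ∞`, `x ∈ ∂K`. -/
def IsCAsymptotic {d : ℕ} (C K : Set (Euc d)) : Prop :=
  IsCPseudo C K ∧
    Tendsto (fun x : Euc d => Metric.infDist x (frontier C))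
      (Bornology.cobounded (Euc d) ⊓ 𝓟 (frontier K)) (𝓝 0)

/-! ### Support function and surface area measure -/

/-- The support function `h_K(y) = sup_{x ∈ K} ⟨x, y⟩`. (For `C`-pseudo `K` and `y ∈ C°` the
supremum is over a nonempty set of nonpositive numbers.) -/
def supportFn {d : ℕ} (K : Set (Euc d)) (y : Euc d) : ℝ :=
  sSup ((fun x : Euc d => ⟪x, y⟫) '' K)

/-- The inverse Gauss image `τ_K(η)`: the boundary points of `K` having an outer normal in `η`. -/
def invGauss {d : ℕ} (K η : Set (Euc d)) : Set (Euc d) :=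
  {x | x ∈ frontier K ∧ ∃ v ∈ η, ⟪x, v⟫ = supportFn K v}

/-- The surface area measure `S_K(η) = H^{m}(τ_K(η))` of `K ⊆ ℝ^{m+1}`, for `η ⊆ Ω`.
`μHE[m]` is the `m`-dimensional Hausdorff measure, normalised as Lebesgue measure on `ℝ^m`. -/
def surfaceArea {m : ℕ} (C K : Set (Euc (m + 1))) (η : Set (Omega C)) : ℝ≥0∞ :=
  μHE[m] (invGauss K (Subtype.val '' η))

/-! ### Monge-Ampere measure -/

/-- The subdifferential at `x` of a function `u` considered on the set `Λ`. -/
def subdiff {m : ℕ} (Λ : Set (Euc m)) (u : Euc m → ℝ) (x : Euc m) : Set (Euc m) :=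
  {p | ∀ z ∈ Λ, u x + ⟪p, z - x⟫ ≤ u z}

/-- The Monge-Ampere measure `M_u(Ξ) = H^{m}(∂u(Ξ))` of `u : Λ → ℝ`, for `Ξ ⊆ Λ`. -/
def mongeAmpere {m : ℕ} (Λ : Set (Euc m)) (u : Euc m → ℝ) (Ξ : Set (Euc m)) : ℝ≥0∞ :=
  μHE[m] (⋃ x ∈ Ξ, subdiff Λ u x)

/-! ### The coordinate system and the projection of the hemisphere -/

/-- The requirements on the unit vector `w` (which is `-e₁` in the chosen coordinates):
`w ∈ int C`, `⟨u, w⟩ > ξ > 0` on `C ∩ S^{d-1}` and `⟨v, w⟩ < -ξ < 0` on `C° ∩ S^{d-1}`. -/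
def IsAxis {d : ℕ} (C : Set (Euc d)) (w : Euc d) : Prop :=
  w ∈ interior C ∧ ‖w‖ = 1 ∧
    ∃ ξ : ℝ, 0 < ξ ∧ (∀ u ∈ C, ‖u‖ = 1 → ξ < ⟪u, w⟫) ∧
      (∀ v ∈ dualCone C, ‖v‖ = 1 → ⟪v, w⟫ < -ξ)

/-- `Φ(x) = (1, x) / √(1 + |x|²)`, in the coordinates of the orthonormal basis `e`. Here
`e 0` is the first basis vector. -/
def Phi {m : ℕ} (e : OrthonormalBasis (Fin (m + 1)) ℝ (Euc (m + 1))) (x : Euc m) :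
    Euc (m + 1) :=
  (Real.sqrt (1 + ‖x‖ ^ 2))⁻¹ • (e 0 + ∑ i : Fin m, x i • e i.succ)

/-- `Φ⁻¹(v) = (⟨v, e₂⟩, …, ⟨v, eₙ⟩) / ⟨v, e₁⟩`, for `v` in the open hemisphere about `e₁`. -/
def PhiInv {m : ℕ} (e : OrthonormalBasis (Fin (m + 1)) ℝ (Euc (m + 1))) (v : Euc (m + 1)) :
    Euc m :=
  (⟪v, e 0⟫)⁻¹ • WithLp.toLp 2 (fun i : Fin m => ⟪v, e i.succ⟫)

/-- The domain `Φ⁻¹(Ω) ⊆ ℝ^m`. -/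
def domain {m : ℕ} (C : Set (Euc (m + 1)))
    (e : OrthonormalBasis (Fin (m + 1)) ℝ (Euc (m + 1))) : Set (Euc m) :=
  Phi e ⁻¹' Omega C

/-- The transported measure `μ̃(Ξ) = ∫_{Φ(Ξ)} |⟨v, e₁⟩| dμ(v)`, for `Ξ ⊆ Φ⁻¹(Ω)`. -/
def transported {m : ℕ} {C : Set (Euc (m + 1))}
    (e : OrthonormalBasis (Fin (m + 1)) ℝ (Euc (m + 1))) (μ : Measure (Omega C))
    (Ξ : Set (Euc m)) : ℝ≥0∞ :=
  ∫⁻ v in {v : Omega C | (v : Euc (m + 1)) ∈ Phi e '' Ξ},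
    ENNReal.ofReal |⟪(v : Euc (m + 1)), e 0⟫| ∂μ

/-- The set `K = ⋂_{v ∈ closure Ω} {z : ⟨z, v⟩ ≤ ⟨v, e₁⟩ u(Φ⁻¹(v))}`. -/
def wulffSet {m : ℕ} (C : Set (Euc (m + 1)))
    (e : OrthonormalBasis (Fin (m + 1)) ℝ (Euc (m + 1))) (u : Euc m → ℝ) :
    Set (Euc (m + 1)) :=
  ⋂ v ∈ closure (Omega C), {z | ⟪z, v⟫ ≤ ⟪v, e 0⟫ * u (PhiInv e v)}

end PseudoCone

end

/-!
In the coordinates `(t, x)` the set `K` is the hypograph of `-u*`, where `u*` is the Legendre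
conjugate of `u` on the compact set `closure (Φ⁻¹ Ω)`, and `C` is the hypograph of `-0*`. As `p`
tends to infinity, a maximiser of `⟨p, ·⟩ - u` is pushed towards the boundary, where `u` vanishes;
hence `u* p - 0* p → 0`, and `∂K` approaches `∂C`.

A boundary point `(-u* p, p)` of `K` has outer normal `Φ x` if and only if `p ∈ ∂u(x)`, that is, if
and only if `∇u* p = x` whenever `u*` is differentiable at `p`, which happens for almost every `p`
by Rademacher's theorem. So `M_u` is the image of Lebesgue measure under `∇u*`, and the area
formula for the graph of `-u*` gives `S_K(Φ(Ξ)) = ∫_Ξ √(1 + |x|²) dM_u(x)`. The weight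
`√(1 + |x|²) = 1 / ⟨Φ x, e₁⟩` cancels the density that defines the transported measure.
-/

noncomputable section

namespace PseudoCone

section Frontier

variable {E : Type*} [NormedAddCommGroup E] [NormedSpace ℝ E] {D : Set E}

theorem exists_add_smul_mem_frontier (hD : Bornology.IsBounded D) {x h : E} (hx : x ∈ closure D)
    (hh : h ≠ 0) : ∃ t : ℝ, 0 ≤ t ∧ x + t • h ∈ frontier D := by
  have hcont : Continuous fun t : ℝ => x + t • h := by fun_prop
  obtain ⟨R, hR⟩ := hD.closure.exists_norm_le
  have hbdd : Bornology.IsBounded ((fun t : ℝ => x + t • h) ⁻¹' closure D) := by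
    refine isBounded_iff_forall_norm_le.2 ⟨(R + ‖x‖) / ‖h‖, fun t ht => ?_⟩
    rw [le_div_iff₀ (norm_pos_iff.2 hh), ← norm_smul]
    calc ‖t • h‖ = ‖(x + t • h) - x‖ := by rw [add_sub_cancel_left]
      _ ≤ R + ‖x‖ := (norm_sub_le _ _).trans (by gcongr; exact hR _ ht)
  obtain ⟨t, ht, hmax⟩ := (Metric.isCompact_of_isClosed_isBounded
    (isClosed_closure.preimage hcont) hbdd).exists_isGreatest ⟨0, by simpa using hx⟩
  refine ⟨t, hmax (by simpa using hx), ht, fun hinter => ?_⟩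
  obtain ⟨s, hts, hs⟩ :=
    (hcont.continuousAt.eventually (isOpen_interior.mem_nhds hinter)).exists_gt
  exact hts.not_ge (hmax (interior_subset_closure hs))

theorem nonpos_of_frontier_eq_zero [Nontrivial E] (hD : Bornology.IsBounded D) {u : E → ℝ}
    (hc : ConvexOn ℝ (closure D) u) (h0 : ∀ x ∈ frontier D, u x = 0) {x : E}
    (hx : x ∈ closure D) : u x ≤ 0 := by
  obtain ⟨h, hh⟩ := exists_ne (0 : E)
  obtain ⟨s, hs, hsf⟩ := exists_add_smul_mem_frontier hD hx hh
  obtain ⟨t, ht, htf⟩ := exists_add_smul_mem_frontier hD hx (neg_ne_zero.2 hh)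
  have hseg : x ∈ segment ℝ (x + s • h) (x + t • -h) := by
    have h0 : (0 : ℝ) ∈ segment ℝ s (-t) := by
      rw [segment_symm, segment_eq_Icc (by linarith)]
      exact ⟨by linarith, hs⟩
    simpa [AffineMap.lineMap_apply_module', add_comm] using
      mem_image_of_mem (AffineMap.lineMap (k := ℝ) x (x + h)) h0
  have := hc.le_max_of_mem_segment (frontier_subset_closure hsf) (frontier_subset_closure htf) hseg
  rwa [h0 _ hsf, h0 _ htf, max_self] at this

end Frontier

section Conjugate

variable {E : Type*} [NormedAddCommGroup E] [InnerProductSpace ℝ E] {Λ : Set E} {u : E → ℝ}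

/-- The Legendre conjugate `u*(p) = sup_{x ∈ Λ} (⟨p, x⟩ - u x)` of a function `u` considered on
the set `Λ`; in the applications `Λ` is compact and `u` is continuous on it. -/
def conjugate (Λ : Set E) (u : E → ℝ) (p : E) : ℝ :=
  sSup ((fun x => ⟪p, x⟫ - u x) '' Λ)

theorem inner_sub_le_conjugate (hΛ : IsCompact Λ) (hu : ContinuousOn u Λ) (p : E) {x : E}
    (hx : x ∈ Λ) : ⟪p, x⟫ - u x ≤ conjugate Λ u p :=
  le_csSup (hΛ.image_of_continuousOn (by fun_prop)).bddAbove (mem_image_of_mem _ hx)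

theorem exists_conjugate_eq (hΛ : IsCompact Λ) (hne : Λ.Nonempty) (hu : ContinuousOn u Λ)
    (p : E) : ∃ x ∈ Λ, conjugate Λ u p = ⟪p, x⟫ - u x :=
  hΛ.exists_sSup_image_eq hne (by fun_prop)

theorem conjugate_le_iff (hΛ : IsCompact Λ) (hne : Λ.Nonempty) (hu : ContinuousOn u Λ)
    {p : E} {a : ℝ} : conjugate Λ u p ≤ a ↔ ∀ x ∈ Λ, ⟪p, x⟫ - u x ≤ a := by
  refine ⟨fun h x hx => (inner_sub_le_conjugate hΛ hu p hx).trans h, fun h => ?_⟩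
  obtain ⟨x, hx, hpx⟩ := exists_conjugate_eq hΛ hne hu p
  exact hpx ▸ h x hx

theorem conjugate_sub_le_inner (hΛ : IsCompact Λ) (hu : ContinuousOn u Λ) {p x : E} (hx : x ∈ Λ)
    (hpx : conjugate Λ u p = ⟪p, x⟫ - u x) (q : E) :
    conjugate Λ u p - conjugate Λ u q ≤ ⟪p - q, x⟫ := by
  have := inner_sub_le_conjugate hΛ hu q hx
  rw [inner_sub_left]
  linarith

theorem exists_lipschitzWith_conjugate (hΛ : IsCompact Λ) (hne : Λ.Nonempty)
    (hu : ContinuousOn u Λ) : ∃ L, LipschitzWith L (conjugate Λ u) := by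
  obtain ⟨R, hR⟩ := hΛ.isBounded.exists_norm_le
  refine ⟨R.toNNReal, LipschitzWith.of_le_add_mul _ fun p q => ?_⟩
  obtain ⟨x, hx, hpx⟩ := exists_conjugate_eq hΛ hne hu p
  rw [← sub_le_iff_le_add', dist_eq_norm]
  calc conjugate Λ u p - conjugate Λ u q ≤ ⟪p - q, x⟫ := conjugate_sub_le_inner hΛ hu hx hpx q
    _ ≤ ‖x‖ * ‖p - q‖ := (real_inner_le_norm _ _).trans_eq (mul_comm _ _)
    _ ≤ R.toNNReal * ‖p - q‖ := by
      gcongr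
      exact (hR x hx).trans (Real.le_coe_toNNReal R)

theorem gradient_conjugate_eq [CompleteSpace E] (hΛ : IsCompact Λ) (hu : ContinuousOn u Λ)
    {p x : E} (hx : x ∈ Λ) (hpx : conjugate Λ u p = ⟪p, x⟫ - u x)
    (hd : DifferentiableAt ℝ (conjugate Λ u) p) : gradient (conjugate Λ u) p = x := by
  have hmin : IsLocalMin (fun q => conjugate Λ u q - innerSL ℝ x q) p := by
    refine Eventually.of_forall fun q => ?_
    have := conjugate_sub_le_inner hΛ hu hx hpx q
    rw [real_inner_comm, inner_sub_right] at this
    simp only [innerSL_apply_apply]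
    linarith
  have h0 := hmin.hasFDerivAt_eq_zero (hd.hasFDerivAt.sub (innerSL ℝ x).hasFDerivAt)
  rw [gradient, sub_eq_zero.1 h0]
  exact (InnerProductSpace.toDual ℝ E).symm_apply_apply x

theorem exists_le_inner_sub_conjugate [CompleteSpace E] (hΛ : IsCompact Λ) (hu : ContinuousOn u Λ)
    (hc : ConvexOn ℝ Λ u) {x : E} (hx : x ∈ Λ) {a : ℝ} (ha : a < u x) :
    ∃ p, a ≤ ⟪p, x⟫ - conjugate Λ u p := by
  obtain ⟨l, c, hle, hl⟩ := ConvexOn.exists_affine_le_of_lt (𝕜 := ℝ) hx ha hΛ.isClosed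
    hu.lowerSemicontinuousOn hc
  simp only [RCLike.re_to_real] at hl
  refine ⟨(InnerProductSpace.toDual ℝ E).symm l, ?_⟩
  have hconj : conjugate Λ u ((InnerProductSpace.toDual ℝ E).symm l) ≤ -c := by
    refine (conjugate_le_iff hΛ ⟨x, hx⟩ hu).2 fun z hz => ?_
    have : l z + c ≤ u z := hle ⟨z, hz⟩
    rw [InnerProductSpace.toDual_symm_apply]
    linarith
  rw [InnerProductSpace.toDual_symm_apply]
  linarith

section Boundary

variable {D : Set E}

theorem exists_mem_frontier_norm_mul_dist_le (hD : IsCompact (closure D))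
    (hu : ContinuousOn u (closure D)) (h0 : ∀ x ∈ frontier D, u x = 0) {p x : E} (hp : p ≠ 0)
    (hx : x ∈ closure D) (hpx : conjugate (closure D) u p = ⟪p, x⟫ - u x) :
    ∃ y ∈ frontier D, ‖p‖ * dist x y ≤ conjugate (closure D) u 0 := by
  obtain ⟨t, ht, hy⟩ := exists_add_smul_mem_frontier (hD.isBounded.subset subset_closure) hx hp
  refine ⟨_, hy, ?_⟩
  have hle := inner_sub_le_conjugate hD hu p (frontier_subset_closure hy)
  have hle0 := inner_sub_le_conjugate hD hu 0 hx
  rw [h0 _ hy, hpx, inner_add_right, inner_smul_right, real_inner_self_eq_norm_sq] at hle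
  rw [inner_zero_left] at hle0
  rw [dist_self_add_right, norm_smul, Real.norm_of_nonneg ht]
  linarith

/-- The ray from a maximiser at `p` in direction `p` leaves `D` after a length `O(1 / ‖p‖)`, so
that for large `p` the maximisers are close to the frontier. -/
theorem tendsto_conjugate_sub_conjugate_zero (hD : IsCompact (closure D)) (hne : D.Nonempty)
    (hu : ContinuousOn u (closure D)) (hu0 : ∀ x ∈ closure D, u x ≤ 0)
    (h0 : ∀ x ∈ frontier D, u x = 0) :
    Tendsto (fun p => conjugate (closure D) u p - conjugate (closure D) 0 p)
      (Bornology.cobounded E) (𝓝 0) := by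
  have hzero : ContinuousOn (0 : E → ℝ) (closure D) := continuousOn_const
  rw [Metric.tendsto_nhds]
  intro ε hε
  obtain ⟨δ, hδ, hunif⟩ :=
    Metric.uniformContinuousOn_iff.1 (hD.uniformContinuousOn_of_continuous hu) ε hε
  filter_upwards [tendsto_norm_cobounded_atTop.eventually_gt_atTop 0,
    tendsto_norm_cobounded_atTop.eventually_gt_atTop (conjugate (closure D) u 0 / δ)]
    with p hp0 hp
  obtain ⟨x, hx, hpx⟩ := exists_conjugate_eq hD hne.closure hu p
  obtain ⟨y, hy, hxy⟩ :=
    exists_mem_frontier_norm_mul_dist_le hD hu h0 (norm_pos_iff.1 hp0) hx hpx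
  have hdist : dist x y < δ := by
    rw [div_lt_iff₀ hδ] at hp
    exact lt_of_mul_lt_mul_left (hxy.trans_lt hp) hp0.le
  have hux : -u x < ε := by
    have := hunif x hx y (frontier_subset_closure hy) hdist
    rw [h0 y hy, Real.dist_0_eq_abs] at this
    exact (neg_le_abs _).trans_lt this
  have hle : conjugate (closure D) u p ≤ conjugate (closure D) 0 p - u x := by
    have := inner_sub_le_conjugate hD hzero p hx
    simp only [Pi.zero_apply] at this
    linarith
  have hge : conjugate (closure D) 0 p ≤ conjugate (closure D) u p := by
    refine (conjugate_le_iff hD hne.closure hzero).2 fun z hz => ?_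
    have := inner_sub_le_conjugate hD hu p hz
    have := hu0 z hz
    simp only [Pi.zero_apply]
    linarith
  rw [Real.dist_0_eq_abs, abs_of_nonneg (by linarith)]
  linarith

end Boundary

end Conjugate

section Subdifferential

variable {m : ℕ} {D : Set (Euc m)} {u : Euc m → ℝ}

theorem mem_subdiff_iff (hD : IsCompact (closure D)) (hu : ContinuousOn u (closure D))
    {x p : Euc m} (hx : x ∈ D) :
    p ∈ subdiff D u x ↔ conjugate (closure D) u p = ⟪p, x⟫ - u x := by
  have hmem : p ∈ subdiff D u x ↔ ∀ z ∈ D, ⟪p, z⟫ - u z ≤ ⟪p, x⟫ - u x := by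
    refine forall₂_congr fun z _ => ?_
    rw [inner_sub_right]
    constructor <;> intro h <;> linarith
  rw [hmem, le_antisymm_iff, and_iff_left (inner_sub_le_conjugate hD hu p (subset_closure hx)),
    conjugate_le_iff hD ⟨x, subset_closure hx⟩ hu]
  refine ⟨fun h z hz => ?_, fun h z hz => h z (subset_closure hz)⟩
  have hcont : ContinuousOn (fun z => ⟪p, z⟫ - u z) (closure D) := by fun_prop
  exact ((hcont z hz).mono subset_closure).closure_le hz continuousWithinAt_const h

end Subdifferential

section AreaFormula

open Module
open scoped NNReal

theorem measure_le_of_forall_subset_le {X : Type*} [MeasurableSpace X] {μ ν : Measure X}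
    {P : ℕ → Set X} (hP : ∀ n, MeasurableSet (P n))
    (h : ∀ n s, MeasurableSet s → s ⊆ P n → μ s ≤ ν s) {s : Set X} (hs : MeasurableSet s)
    (hsP : s ⊆ ⋃ n, P n) : μ s ≤ ν s := by
  have hunion : s = ⋃ n, s ∩ disjointed P n := by
    rw [← inter_iUnion, iUnion_disjointed, inter_eq_left.2 hsP]
  have hmeas : ∀ n, MeasurableSet (s ∩ disjointed P n) := fun n =>
    hs.inter (MeasurableSet.disjointed hP n)
  have hdisj : Pairwise (Function.onFun Disjoint fun n => s ∩ disjointed P n) := fun i j hij =>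
    (disjoint_disjointed P hij).mono inter_subset_right inter_subset_right
  rw [hunion, measure_iUnion hdisj hmeas, measure_iUnion hdisj hmeas]
  exact ENNReal.tsum_le_tsum fun n =>
    h n _ (hmeas n) (inter_subset_right.trans (disjointed_subset P n))

theorem le_of_forall_one_lt_le_pow_mul {a b : ℝ≥0∞} (k : ℕ)
    (h : ∀ c : ℝ≥0, 1 < c → a ≤ (c : ℝ≥0∞) ^ k * b) : a ≤ b := by
  have hlim : Tendsto (fun c : ℝ≥0 => (c : ℝ≥0∞) ^ k * b) (𝓝[>] 1) (𝓝 (1 ^ k * b)) := by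
    refine ENNReal.Tendsto.mul_const (Tendsto.mono_left ?_ nhdsWithin_le_nhds)
      (Or.inl (pow_ne_zero k one_ne_zero))
    exact ((ENNReal.continuous_pow k).comp ENNReal.continuous_coe).tendsto 1
  rw [one_pow, one_mul] at hlim
  exact ge_of_tendsto hlim (eventually_mem_nhdsWithin.mono h)

theorem euclideanHausdorffMeasure_image_le_of_dist_le {X Y Z : Type*} [MetricSpace Y]
    [MeasurableSpace Y] [BorelSpace Y] [MetricSpace Z] [MeasurableSpace Z] [BorelSpace Z]
    {F : X → Y} {G : X → Z} {P : Set X} {c : ℝ≥0}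
    (h : ∀ p ∈ P, ∀ q ∈ P, dist (F p) (F q) ≤ c * dist (G p) (G q)) (d : ℕ) :
    μHE[d] (F '' P) ≤ (c : ℝ≥0∞) ^ d * μHE[d] (G '' P) := by
  rcases P.eq_empty_or_nonempty with rfl | ⟨p₀, -⟩
  · simp
  have : Nonempty X := ⟨p₀⟩
  set g := Function.invFunOn G P
  have hg : ∀ p ∈ P, g (G p) ∈ P ∧ G (g (G p)) = G p := fun p hp =>
    ⟨Function.invFunOn_mem ⟨p, hp, rfl⟩, Function.invFunOn_eq ⟨p, hp, rfl⟩⟩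
  have hFg : F '' P = (F ∘ g) '' (G '' P) := by
    rw [image_image]
    refine image_congr fun p hp => dist_le_zero.1 ?_
    have := h p hp _ (hg p hp).1
    rwa [(hg p hp).2, dist_self, mul_zero] at this
  have hL : LipschitzOnWith c (F ∘ g) (G '' P) := by
    refine LipschitzOnWith.of_dist_le_mul ?_
    rintro _ ⟨p, hp, rfl⟩ _ ⟨q, hq, rfl⟩
    have := h _ (hg p hp).1 _ (hg q hq).1
    rwa [(hg p hp).2, (hg q hq).2] at this
  have hH := hL.hausdorffMeasure_image_le (d := d) d.cast_nonneg
  rw [ENNReal.rpow_natCast] at hH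
  simp only [hFg, Measure.euclideanHausdorffMeasure_def, Measure.smul_apply, mul_smul_comm]
  gcongr

theorem euclideanHausdorffMeasure_image_eq_zero_of_lipschitzWith {E Y : Type*}
    [NormedAddCommGroup E] [InnerProductSpace ℝ E] [FiniteDimensional ℝ E] [MeasurableSpace E]
    [BorelSpace E] [MetricSpace Y] [MeasurableSpace Y] [BorelSpace Y] {F : E → Y} {L : ℝ≥0}
    (hF : LipschitzWith L F) {s : Set E} (hs : volume s = 0) :
    μHE[finrank ℝ E] (F '' s) = 0 := by
  have := euclideanHausdorffMeasure_image_le_of_dist_le (P := s) (G := id)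
    (fun p _ q _ => hF.dist_le_mul p q) (finrank ℝ E)
  rw [image_id, InnerProductSpace.euclideanHausdorffMeasure_eq_volume, hs, mul_zero] at this
  exact le_antisymm this zero_le

section Comparable

variable {E V : Type*} [NormedAddCommGroup E] [NormedSpace ℝ E] [NormedAddCommGroup V]
  [NormedSpace ℝ V] {F : E → V}

theorem norm_le_mul_norm_fderiv_of_antilipschitzWith {K : ℝ≥0}
    (hF : AntilipschitzWith K F) {x : E} (hd : DifferentiableAt ℝ F x) (v : E) :
    ‖v‖ ≤ K * ‖fderiv ℝ F x v‖ := by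
  have hlim := (hd.hasFDerivAt.hasLineDerivAt v).tendsto_slope_zero
  refine ge_of_tendsto (hlim.norm.const_mul (K : ℝ)) ?_
  filter_upwards [self_mem_nhdsWithin] with t ht
  have ht' : 0 < ‖t‖ := norm_pos_iff.2 ht
  have h := hF.le_mul_dist (x + t • v) x
  rw [dist_self_add_left, dist_eq_norm, norm_smul] at h
  rw [norm_smul, norm_inv, ← mul_assoc, mul_comm (K : ℝ), mul_assoc, le_inv_mul_iff₀ ht']
  exact h

/-- On `P`, the map `F` and all its derivatives are `c`-bi-Lipschitz comparable with the linear
map `A`: the local form in which a differentiable map enters the area formula. -/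
structure IsComparableOn (c : ℝ≥0) (F : E → V) (A : E →L[ℝ] V) (P : Set E) : Prop where
  dist_le : ∀ p ∈ P, ∀ q ∈ P, dist (F p) (F q) ≤ c * dist (A p) (A q)
  le_dist : ∀ p ∈ P, ∀ q ∈ P, dist (A p) (A q) ≤ c * dist (F p) (F q)
  norm_fderiv_le : ∀ p ∈ P, ∀ v, ‖fderiv ℝ F p v‖ ≤ c * ‖A v‖
  le_norm_fderiv : ∀ p ∈ P, ∀ v, ‖A v‖ ≤ c * ‖fderiv ℝ F p v‖

variable {A : E →L[ℝ] V} {P : Set E} {c : ℝ≥0}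

theorem IsComparableOn.mono (h : IsComparableOn c F A P) {Q : Set E} (hQ : Q ⊆ P) :
    IsComparableOn c F A Q where
  dist_le p hp q hq := h.dist_le p (hQ hp) q (hQ hq)
  le_dist p hp q hq := h.le_dist p (hQ hp) q (hQ hq)
  norm_fderiv_le p hp := h.norm_fderiv_le p (hQ hp)
  le_norm_fderiv p hp := h.le_norm_fderiv p (hQ hp)

theorem isComparableOn_of_approximatesLinearOn {K δ : ℝ≥0} (hc : 1 ≤ c) (hδ : K * δ * c ≤ c - 1)
    (hA : ∀ v, ‖v‖ ≤ K * ‖A v‖) (hF : ApproximatesLinearOn F A P δ)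
    (hF' : ∀ p ∈ P, ‖fderiv ℝ F p - A‖ ≤ δ) : IsComparableOn c F A P := by
  have hδ' : (K : ℝ) * δ * c ≤ c - 1 := by
    rw [← NNReal.coe_one, ← NNReal.coe_sub hc]
    exact_mod_cast hδ
  have hc' : (1 : ℝ) ≤ c := hc
  have hclose : ∀ (v : E) (w : V), ‖w - A v‖ ≤ δ * ‖v‖ → ‖w‖ ≤ c * ‖A v‖ ∧ ‖A v‖ ≤ c * ‖w‖ := by
    intro v w hw
    have hw' : c * ‖w - A v‖ ≤ (c - 1) * ‖A v‖ := by
      calc (c : ℝ) * ‖w - A v‖ ≤ c * (δ * (K * ‖A v‖)) := by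
            gcongr
            exact hw.trans (by gcongr; exact hA v)
        _ = K * δ * c * ‖A v‖ := by ring
        _ ≤ (c - 1) * ‖A v‖ := by gcongr
    have h1 := norm_le_norm_add_norm_sub' w (A v)
    have h2 := mul_le_mul_of_nonneg_left (norm_le_norm_add_norm_sub' (A v) w) c.coe_nonneg
    have h3 : ‖w - A v‖ ≤ c * ‖w - A v‖ := le_mul_of_one_le_left (norm_nonneg _) hc'
    rw [norm_sub_rev (A v), mul_add] at h2
    exact ⟨by linarith, by linarith⟩
  have hdist : ∀ p ∈ P, ∀ q ∈ P, ‖F p - F q‖ ≤ c * ‖A (p - q)‖ ∧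
      ‖A (p - q)‖ ≤ c * ‖F p - F q‖ := fun p hp q hq => hclose _ _ (hF p hp q hq)
  have hderiv : ∀ p ∈ P, ∀ v, ‖fderiv ℝ F p v‖ ≤ c * ‖A v‖ ∧ ‖A v‖ ≤ c * ‖fderiv ℝ F p v‖ :=
    fun p hp v => hclose v _ (ContinuousLinearMap.le_of_opNorm_le _ (hF' p hp) v)
  simp only [map_sub, ← dist_eq_norm] at hdist
  exact ⟨fun p hp q hq => (hdist p hp q hq).1, fun p hp q hq => (hdist p hp q hq).2,
    fun p hp v => (hderiv p hp v).1, fun p hp v => (hderiv p hp v).2⟩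

theorem exists_isComparableOn_cover [FiniteDimensional ℝ E] [FiniteDimensional ℝ V]
    [MeasurableSpace E] [BorelSpace E] {K : ℝ≥0} (hF : AntilipschitzWith K F) (hc : 1 < c) :
    ∃ P : ℕ → Set E, (∀ n, MeasurableSet (P n)) ∧
      {x | DifferentiableAt ℝ F x} ⊆ ⋃ n, P n ∧ ∀ n, ∃ A, IsComparableOn c F A (P n) := by
  obtain ⟨δ, hδ, hKδ⟩ : ∃ δ : ℝ≥0, 0 < δ ∧ K * (δ + δ) * c ≤ c - 1 := by
    have hlim : Tendsto (fun δ : ℝ≥0 => K * (δ + δ) * c) (𝓝[>] 0) (𝓝 (K * (0 + 0) * c)) :=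
      (Continuous.tendsto (by fun_prop) 0).mono_left nhdsWithin_le_nhds
    rw [add_zero, mul_zero, zero_mul] at hlim
    exact (eventually_mem_nhdsWithin.and
      (hlim.eventually_le_const (tsub_pos_of_lt hc))).exists
  set a := TopologicalSpace.denseSeq (E →L[ℝ] V)
  set s : ℕ → Set E := fun k => {x | DifferentiableAt ℝ F x} ∩ fderiv ℝ F ⁻¹' Metric.ball (a k) δ
  have hs : ∀ k, MeasurableSet (s k) := fun k =>
    (measurableSet_of_differentiableAt ℝ F).inter (measurable_fderiv ℝ F measurableSet_ball)
  choose t A _ ht hst happrox hA using fun k =>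
    exists_partition_approximatesLinearOn_of_hasFDerivWithinAt F (s k) (fderiv ℝ F)
      (fun x hx => hx.1.hasFDerivAt.hasFDerivWithinAt) (fun _ => δ + δ)
      (fun _ => (add_pos hδ hδ).ne')
  refine ⟨fun n => s n.unpair.1 ∩ t n.unpair.1 n.unpair.2, fun n => (hs _).inter (ht _ _),
    fun x hx => ?_, fun n => ⟨A n.unpair.1 n.unpair.2, ?_⟩⟩
  · obtain ⟨k, hk⟩ := (TopologicalSpace.denseRange_denseSeq (E →L[ℝ] V)).exists_dist_lt
      (fderiv ℝ F x) (ε := δ) hδ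
    rw [iUnion_unpair fun k n => s k ∩ t k n, mem_iUnion]
    exact ⟨k, by rw [← inter_iUnion]; exact ⟨⟨hx, hk⟩, hst k ⟨hx, hk⟩⟩⟩
  · rcases (s n.unpair.1).eq_empty_or_nonempty with hempty | hne
    · constructor <;> simp [hempty]
    obtain ⟨y, hy, hAy⟩ := hA _ hne n.unpair.2
    refine isComparableOn_of_approximatesLinearOn hc.le hKδ ?_ (happrox _ _) fun p hp => ?_
    · rw [hAy]
      exact norm_le_mul_norm_fderiv_of_antilipschitzWith hF hy.1
    · rw [hAy, ← dist_eq_norm]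
      exact (dist_triangle_right _ _ (a n.unpair.1)).trans (add_le_add hp.1.2.le hy.2.le)

end Comparable

section InnerProductSpace

variable {E V : Type*} [NormedAddCommGroup E] [InnerProductSpace ℝ E] [FiniteDimensional ℝ E]
  [NormedAddCommGroup V] [InnerProductSpace ℝ V]

theorem ofReal_normDet_le_of_norm_le {A B : E →ₗ[ℝ] V} {c : ℝ≥0} (h : ∀ v, ‖A v‖ ≤ c * ‖B v‖) :
    ENNReal.ofReal A.normDet ≤ (c : ℝ≥0∞) ^ finrank ℝ E * ENNReal.ofReal B.normDet := by
  borelize E V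
  have hdist : ∀ p ∈ Metric.ball (0 : E) 1, ∀ q ∈ Metric.ball (0 : E) 1,
      dist (A p) (A q) ≤ c * dist (B p) (B q) := fun p _ q _ => by
    rw [dist_eq_norm, dist_eq_norm, ← map_sub, ← map_sub]
    exact h _
  have := euclideanHausdorffMeasure_image_le_of_dist_le hdist (finrank ℝ E)
  rw [A.euclideanHausdorffMeasure_image_eq_normDet_mul_volume,
    B.euclideanHausdorffMeasure_image_eq_normDet_mul_volume, ← mul_assoc] at this
  exact (ENNReal.mul_le_mul_iff_left (Metric.measure_ball_pos volume 0 one_pos).ne'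
    measure_ball_lt_top.ne).1 this

variable [MeasurableSpace E] [BorelSpace E] [MeasurableSpace V] [BorelSpace V]
  {F : E → V} {A : E →L[ℝ] V} {P : Set E} {c : ℝ≥0}

theorem IsComparableOn.image_le_lintegral (h : IsComparableOn c F A P) (hP : MeasurableSet P) :
    μHE[finrank ℝ E] (F '' P) ≤ (c : ℝ≥0∞) ^ (finrank ℝ E + finrank ℝ E) *
      ∫⁻ x in P, ENNReal.ofReal (fderiv ℝ F x).normDet := by
  calc μHE[finrank ℝ E] (F '' P)
      ≤ (c : ℝ≥0∞) ^ finrank ℝ E * μHE[finrank ℝ E] (A '' P) :=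
        euclideanHausdorffMeasure_image_le_of_dist_le h.dist_le _
    _ = (c : ℝ≥0∞) ^ finrank ℝ E * ∫⁻ _ in P, ENNReal.ofReal A.normDet := by
        rw [setLIntegral_const]
        congr 1
        exact LinearMap.euclideanHausdorffMeasure_image_eq_normDet_mul_volume (A : E →ₗ[ℝ] V) P
    _ ≤ (c : ℝ≥0∞) ^ finrank ℝ E * ∫⁻ x in P, (c : ℝ≥0∞) ^ finrank ℝ E *
          ENNReal.ofReal (fderiv ℝ F x).normDet := by
        gcongr _ * ?_
        exact setLIntegral_mono' hP fun x hx => ofReal_normDet_le_of_norm_le (h.le_norm_fderiv x hx)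
    _ = _ := by
        rw [lintegral_const_mul' _ _ (ENNReal.pow_ne_top ENNReal.coe_ne_top), ← mul_assoc, pow_add]

theorem IsComparableOn.lintegral_le_image (h : IsComparableOn c F A P) (hP : MeasurableSet P) :
    ∫⁻ x in P, ENNReal.ofReal (fderiv ℝ F x).normDet ≤
      (c : ℝ≥0∞) ^ (finrank ℝ E + finrank ℝ E) * μHE[finrank ℝ E] (F '' P) := by
  calc ∫⁻ x in P, ENNReal.ofReal (fderiv ℝ F x).normDet
      ≤ ∫⁻ _ in P, (c : ℝ≥0∞) ^ finrank ℝ E * ENNReal.ofReal A.normDet :=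
        setLIntegral_mono' hP fun x hx => ofReal_normDet_le_of_norm_le (h.norm_fderiv_le x hx)
    _ = (c : ℝ≥0∞) ^ finrank ℝ E * μHE[finrank ℝ E] (A '' P) := by
        rw [setLIntegral_const, mul_assoc]
        congr 1
        exact (LinearMap.euclideanHausdorffMeasure_image_eq_normDet_mul_volume
          (A : E →ₗ[ℝ] V) P).symm
    _ ≤ (c : ℝ≥0∞) ^ finrank ℝ E * ((c : ℝ≥0∞) ^ finrank ℝ E * μHE[finrank ℝ E] (F '' P)) := by
        gcongr
        exact euclideanHausdorffMeasure_image_le_of_dist_le h.le_dist _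
    _ = _ := by rw [← mul_assoc, pow_add]

theorem euclideanHausdorffMeasure_image_eq_lintegral_of_differentiableAt [FiniteDimensional ℝ V]
    {K : ℝ≥0} (hF : MeasurableEmbedding F) (hK : AntilipschitzWith K F) {s : Set E}
    (hs : MeasurableSet s) (hd : s ⊆ {x | DifferentiableAt ℝ F x}) :
    μHE[finrank ℝ E] (F '' s) = ∫⁻ x in s, ENNReal.ofReal (fderiv ℝ F x).normDet := by
  set ν := Measure.comap F μHE[finrank ℝ E]
  set ρ := volume.withDensity fun x => ENNReal.ofReal (fderiv ℝ F x).normDet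
  have hν : ∀ t, ν t = μHE[finrank ℝ E] (F '' t) := hF.comap_apply _
  have hρ : ∀ t, ρ t = ∫⁻ x in t, ENNReal.ofReal (fderiv ℝ F x).normDet :=
    fun t => withDensity_apply' _ t
  rw [← hν, ← hρ]
  set d := finrank ℝ E + finrank ℝ E
  refine le_antisymm (le_of_forall_one_lt_le_pow_mul d fun c hc => ?_)
    (le_of_forall_one_lt_le_pow_mul d fun c hc => ?_) <;>
    obtain ⟨P, hP, hcover, hcomp⟩ := exists_isComparableOn_cover hK hc
  · refine measure_le_of_forall_subset_le (ν := (c : ℝ≥0∞) ^ d • ρ) hP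
      (fun n t ht htP => ?_) hs (hd.trans hcover)
    obtain ⟨A, hA⟩ := hcomp n
    rw [hν, Measure.smul_apply, hρ]
    exact (hA.mono htP).image_le_lintegral ht
  · refine measure_le_of_forall_subset_le (ν := (c : ℝ≥0∞) ^ d • ν) hP
      (fun n t ht htP => ?_) hs (hd.trans hcover)
    obtain ⟨A, hA⟩ := hcomp n
    rw [hρ, Measure.smul_apply, hν]
    exact (hA.mono htP).lintegral_le_image ht

theorem euclideanHausdorffMeasure_image_eq_lintegral [FiniteDimensional ℝ V]
    {L K : ℝ≥0} (hL : LipschitzWith L F) (hK : AntilipschitzWith K F) (s : Set E) :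
    μHE[finrank ℝ E] (F '' s) = ∫⁻ x in s, ENNReal.ofReal (fderiv ℝ F x).normDet := by
  have hF : MeasurableEmbedding F :=
    (hK.isClosedEmbedding hL.uniformContinuous).measurableEmbedding
  set N := {x | DifferentiableAt ℝ F x}ᶜ
  have hN : volume N = 0 := hL.ae_differentiableAt
  have hνN : Measure.comap F μHE[finrank ℝ E] N = 0 := by
    rw [hF.comap_apply]
    exact euclideanHausdorffMeasure_image_eq_zero_of_lipschitzWith hL hN
  have hρN := withDensity_absolutelyContinuous volume
    (fun x => ENNReal.ofReal (fderiv ℝ F x).normDet) hN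
  rw [← hF.comap_apply, ← withDensity_apply']
  congr 1
  ext t ht
  rw [← measure_sdiff_null hνN, ← measure_sdiff_null hρN, hF.comap_apply, withDensity_apply']
  exact euclideanHausdorffMeasure_image_eq_lintegral_of_differentiableAt hF hK
    (ht.diff (measurableSet_of_differentiableAt ℝ F).compl) fun x hx => not_not.1 hx.2

end InnerProductSpace

end AreaFormula

section Graph

open Module
open scoped NNReal

variable {E V : Type*} [NormedAddCommGroup E] [InnerProductSpace ℝ E] [NormedAddCommGroup V]
  [InnerProductSpace ℝ V] {J : E →ₗᵢ[ℝ] V} {w : V}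

theorem inner_smul_add_map (hw : ‖w‖ = 1) (hJ : ∀ x, ⟪J x, w⟫ = 0) (s t : ℝ) (x y : E) :
    ⟪s • w + J x, t • w + J y⟫ = s * t + ⟪x, y⟫ := by
  have hJ' : ∀ x, ⟪w, J x⟫ = 0 := fun x => by rw [real_inner_comm, hJ]
  simp only [inner_add_left, inner_add_right, inner_smul_left, inner_smul_right, hJ, hJ',
    real_inner_self_eq_norm_sq, hw, J.inner_map_map, conj_trivial, mul_zero, add_zero, zero_add,
    one_pow, mul_one, mul_comm t s]

theorem norm_sq_smul_add_map (hw : ‖w‖ = 1) (hJ : ∀ x, ⟪J x, w⟫ = 0) (t : ℝ) (x : E) :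
    ‖t • w + J x‖ ^ 2 = t ^ 2 + ‖x‖ ^ 2 := by
  rw [← real_inner_self_eq_norm_sq, inner_smul_add_map hw hJ, real_inner_self_eq_norm_sq, sq t]

theorem normDet_smulRight_add (hw : ‖w‖ = 1) (hJ : ∀ x, ⟪J x, w⟫ = 0) [FiniteDimensional ℝ E]
    [FiniteDimensional ℝ V] (a : E) :
    ((innerSL ℝ a).smulRight w + J.toContinuousLinearMap : E →L[ℝ] V).normDet =
      √(1 + ‖a‖ ^ 2) := by
  set A : E →ₗ[ℝ] V :=
    ((innerSL ℝ a).smulRight w + J.toContinuousLinearMap : E →L[ℝ] V).toLinearMap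
  have hA : ∀ x, A x = ⟪a, x⟫ • w + J x := fun x => rfl
  have hgram : A.adjoint ∘ₗ A = LinearMap.transvection (innerₛₗ ℝ a) a := by
    ext x
    refine ext_inner_right ℝ fun y => ?_
    rw [LinearMap.comp_apply, LinearMap.adjoint_inner_left, hA, hA, inner_smul_add_map hw hJ,
      LinearMap.transvection.apply, inner_add_left, inner_smul_left, innerₛₗ_apply_apply,
      conj_trivial, add_comm]
  have hsq : A.normDet ^ 2 = (A.adjoint ∘ₗ A).det := A.normDet_sq
  rw [hgram, LinearMap.transvection.det, innerₛₗ_apply_apply, real_inner_self_eq_norm_sq] at hsq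
  rw [← hsq, Real.sqrt_sq A.normDet_nonneg]

theorem antilipschitzWith_graph (hw : ‖w‖ = 1) (hJ : ∀ x, ⟪J x, w⟫ = 0) (f : E → ℝ) :
    AntilipschitzWith 1 fun p => f p • w + J p := by
  refine AntilipschitzWith.of_le_mul_dist fun p q => ?_
  have hsub : f p • w + J p - (f q • w + J q) = (f p - f q) • w + J (p - q) := by
    rw [sub_smul, map_sub]
    abel
  rw [NNReal.coe_one, one_mul, dist_eq_norm, dist_eq_norm, hsub]
  refine le_of_sq_le_sq ?_ (norm_nonneg _)
  rw [norm_sq_smul_add_map hw hJ]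
  exact le_add_of_nonneg_left (sq_nonneg _)

theorem lipschitzWith_graph {f : E → ℝ} {L : ℝ≥0} (hf : LipschitzWith L f) :
    ∃ L', LipschitzWith L' fun p => f p • w + J p :=
  ⟨_, (((ContinuousLinearMap.toSpanSingleton ℝ w).lipschitz.comp hf).add J.lipschitz)⟩

theorem euclideanHausdorffMeasure_graph [FiniteDimensional ℝ E] [MeasurableSpace E] [BorelSpace E]
    [FiniteDimensional ℝ V] [MeasurableSpace V] [BorelSpace V] (hw : ‖w‖ = 1)
    (hJ : ∀ x, ⟪J x, w⟫ = 0) {f : E → ℝ} {L : ℝ≥0} (hf : LipschitzWith L f) (s : Set E) :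
    μHE[finrank ℝ E] ((fun p => f p • w + J p) '' s) =
      ∫⁻ p in s, ENNReal.ofReal √(1 + ‖gradient f p‖ ^ 2) := by
  obtain ⟨L', hL'⟩ := lipschitzWith_graph (J := J) (w := w) hf
  rw [euclideanHausdorffMeasure_image_eq_lintegral hL' (antilipschitzWith_graph hw hJ f)]
  refine lintegral_congr_ae (ae_restrict_of_ae ?_)
  filter_upwards [hf.ae_differentiableAt] with p hp
  have hder : HasFDerivAt (fun p => f p • w + J p)
      ((innerSL ℝ (gradient f p)).smulRight w + J.toContinuousLinearMap) p := by
    have hgrad : innerSL ℝ (gradient f p) = fderiv ℝ f p :=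
      (InnerProductSpace.toDual ℝ E).apply_symm_apply _
    rw [hgrad]
    exact (hp.hasFDerivAt.smul_const w).add J.toContinuousLinearMap.hasFDerivAt
  rw [hder.fderiv, normDet_smulRight_add hw hJ]

end Graph

section Coordinates

variable {m : ℕ} (e : OrthonormalBasis (Fin (m + 1)) ℝ (Euc (m + 1)))

/-- The embedding `x ↦ (0, x)` of `ℝ^m` as the hyperplane orthogonal to the first vector of the
basis `e`. -/
def horizontal : Euc m →ₗᵢ[ℝ] Euc (m + 1) where
  toFun x := ∑ i : Fin m, x i • e i.succ
  map_add' x y := by simp only [PiLp.add_apply, add_smul, Finset.sum_add_distrib]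
  map_smul' c x := by simp only [PiLp.smul_apply, smul_eq_mul, mul_smul, Finset.smul_sum,
    RingHom.id_apply]
  norm_map' x := by
    have hx := (e.orthonormal.comp _ (Fin.succ_injective m)).inner_sum x x Finset.univ
    rw [← sq_eq_sq₀ (norm_nonneg _) (norm_nonneg _), EuclideanSpace.real_norm_sq_eq x,
      ← real_inner_self_eq_norm_sq]
    exact hx.trans (Finset.sum_congr rfl fun i _ => (sq (x i)).symm)

/-- The point with coordinates `(t, x)` with respect to the basis `e`. -/
def pt (t : ℝ) (x : Euc m) : Euc (m + 1) := t • e 0 + horizontal e x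

/-- The last `m` coordinates of a point with respect to the basis `e`. -/
def tail : Euc (m + 1) →L[ℝ] Euc m := (horizontal e).toContinuousLinearMap.adjoint

theorem inner_horizontal_zero (x : Euc m) : ⟪horizontal e x, e 0⟫ = 0 := by
  have h : ∀ i : Fin m, ⟪e i.succ, e 0⟫ = 0 := fun i => e.orthonormal.2 (Fin.succ_ne_zero i)
  change ⟪∑ i : Fin m, x i • e i.succ, e 0⟫ = 0
  simp only [sum_inner, inner_smul_left, h, mul_zero, Finset.sum_const_zero]

theorem inner_pt_left (t : ℝ) (x : Euc m) (z : Euc (m + 1)) :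
    ⟪pt e t x, z⟫ = t * ⟪z, e 0⟫ + ⟪x, tail e z⟫ := by
  rw [pt, tail, inner_add_left, inner_smul_left, real_inner_comm,
    ContinuousLinearMap.adjoint_inner_right]
  rfl

theorem inner_pt_pt (t s : ℝ) (x y : Euc m) : ⟪pt e t x, pt e s y⟫ = t * s + ⟪x, y⟫ :=
  inner_smul_add_map (e.norm_eq_one 0) (inner_horizontal_zero e) t s x y

theorem norm_sq_pt (t : ℝ) (x : Euc m) : ‖pt e t x‖ ^ 2 = t ^ 2 + ‖x‖ ^ 2 :=
  norm_sq_smul_add_map (e.norm_eq_one 0) (inner_horizontal_zero e) t x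

theorem pt_zero (t : ℝ) : pt e t 0 = t • e 0 := by rw [pt, (horizontal e).map_zero, add_zero]

theorem smul_pt (c t : ℝ) (x : Euc m) : c • pt e t x = pt e (c * t) (c • x) := by
  rw [pt, pt, smul_add, smul_smul, map_smul]

theorem inner_pt_zero (t : ℝ) (x : Euc m) : ⟪pt e t x, e 0⟫ = t := by
  have := inner_pt_pt e t 1 x 0
  rwa [pt_zero, one_smul, inner_zero_right, add_zero, mul_one] at this

theorem tail_pt (t : ℝ) (x : Euc m) : tail e (pt e t x) = x := by
  refine ext_inner_left ℝ fun y => ?_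
  have := inner_pt_left e 0 y (pt e t x)
  rwa [inner_pt_pt, zero_mul, zero_mul, zero_add, zero_add, eq_comm] at this

theorem tail_apply (z : Euc (m + 1)) (i : Fin m) : tail e z i = ⟪z, e i.succ⟫ := by
  have hi : pt e 0 (EuclideanSpace.single i 1) = e i.succ := by
    rw [pt, zero_smul, zero_add]
    change ∑ j : Fin m, (EuclideanSpace.single i (1 : ℝ)) j • e j.succ = e i.succ
    simp
  have := inner_pt_left e 0 (EuclideanSpace.single i 1) z
  rwa [hi, zero_mul, zero_add, EuclideanSpace.inner_single_left, map_one, one_mul, eq_comm,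
    real_inner_comm] at this

theorem pt_tail (z : Euc (m + 1)) : pt e ⟪z, e 0⟫ (tail e z) = z := by
  conv_rhs => rw [← e.sum_repr' z, Fin.sum_univ_succ]
  change _ + ∑ i : Fin m, tail e z i • e i.succ = _
  simp only [tail_apply, real_inner_comm z]

theorem Phi_eq (x : Euc m) : Phi e x = (√(1 + ‖x‖ ^ 2))⁻¹ • pt e 1 x := by
  rw [Phi, pt, one_smul]
  rfl

theorem PhiInv_eq (v : Euc (m + 1)) : PhiInv e v = (⟪v, e 0⟫)⁻¹ • tail e v := by
  rw [PhiInv]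
  congr 1
  ext i
  exact (tail_apply e v i).symm

theorem sqrt_one_add_norm_sq_pos (x : Euc m) : 0 < √(1 + ‖x‖ ^ 2) := by positivity

theorem continuous_Phi : Continuous (Phi e) := by
  have h : ∀ x : Euc m, √(1 + ‖x‖ ^ 2) ≠ 0 := fun x => (sqrt_one_add_norm_sq_pos x).ne'
  unfold Phi
  fun_prop (disch := exact h _)

theorem inner_Phi_zero (x : Euc m) : ⟪Phi e x, e 0⟫ = (√(1 + ‖x‖ ^ 2))⁻¹ := by
  rw [Phi_eq, smul_pt, inner_pt_zero, mul_one]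

theorem inner_Phi (z : Euc (m + 1)) (x : Euc m) :
    ⟪z, Phi e x⟫ = (√(1 + ‖x‖ ^ 2))⁻¹ * (⟪z, e 0⟫ + ⟪tail e z, x⟫) := by
  rw [Phi_eq, inner_smul_right, real_inner_comm, inner_pt_left, one_mul, real_inner_comm x]

theorem norm_Phi (x : Euc m) : ‖Phi e x‖ = 1 := by
  have hpt : ‖pt e 1 x‖ = √(1 + ‖x‖ ^ 2) := by
    rw [← Real.sqrt_sq (norm_nonneg (pt e 1 x)), norm_sq_pt, one_pow]
  rw [Phi_eq, norm_smul, hpt, norm_inv, Real.norm_of_nonneg (Real.sqrt_nonneg _),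
    inv_mul_cancel₀ (sqrt_one_add_norm_sq_pos x).ne']

theorem PhiInv_Phi (x : Euc m) : PhiInv e (Phi e x) = x := by
  have h : tail e (Phi e x) = (√(1 + ‖x‖ ^ 2))⁻¹ • x := by
    rw [Phi_eq, smul_pt, tail_pt]
  rw [PhiInv_eq, inner_Phi_zero, h, smul_smul, inv_inv,
    mul_inv_cancel₀ (sqrt_one_add_norm_sq_pos x).ne', one_smul]

theorem Phi_PhiInv {v : Euc (m + 1)} (hv : ‖v‖ = 1) (h0 : 0 < ⟪v, e 0⟫) :
    Phi e (PhiInv e v) = v := by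
  have h1 : ⟪v, e 0⟫ ^ 2 + ‖tail e v‖ ^ 2 = 1 := by
    rw [← norm_sq_pt, pt_tail, hv, one_pow]
  have h2 : 1 + ‖(⟪v, e 0⟫)⁻¹ • tail e v‖ ^ 2 = (⟪v, e 0⟫⁻¹) ^ 2 := by
    rw [norm_smul, mul_pow, norm_inv, Real.norm_of_nonneg h0.le]
    field_simp
    exact h1
  rw [Phi_eq, PhiInv_eq, h2, Real.sqrt_sq (by positivity), inv_inv, smul_pt, smul_smul, mul_one,
    mul_inv_cancel₀ h0.ne', one_smul, pt_tail]

end Coordinates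

section DualCone

variable {d : ℕ} {C S : Set (Euc d)}

theorem isClosed_dualCone (S : Set (Euc d)) : IsClosed (dualCone S) := by
  simp only [dualCone, ofPred_forall]
  exact isClosed_biInter fun x _ => isClosed_le (by fun_prop) continuous_const

theorem convex_dualCone (S : Set (Euc d)) : Convex ℝ (dualCone S) := by
  intro y hy z hz a b ha hb _ x hx
  rw [inner_add_right, inner_smul_right, inner_smul_right]
  exact add_nonpos (mul_nonpos_of_nonneg_of_nonpos ha (hy x hx))
    (mul_nonpos_of_nonneg_of_nonpos hb (hz x hx))

theorem smul_mem_dualCone {y : Euc d} (hy : y ∈ dualCone S) {r : ℝ} (hr : 0 ≤ r) :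
    r • y ∈ dualCone S := fun x hx => by
  rw [inner_smul_right]
  exact mul_nonpos_of_nonneg_of_nonpos hr (hy x hx)

open scoped Pointwise in
theorem smul_mem_interior_dualCone {y : Euc d} (hy : y ∈ interior (dualCone S)) {r : ℝ}
    (hr : 0 < r) : r • y ∈ interior (dualCone S) := by
  have hsub : r • dualCone S ⊆ dualCone S := by
    rintro _ ⟨z, hz, rfl⟩
    exact smul_mem_dualCone hz hr.le
  refine interior_mono hsub ?_
  rw [interior_smul₀ hr.ne']
  exact smul_mem_smul_set hy

theorem dualCone_closure (S : Set (Euc d)) : dualCone (closure S) = dualCone S := by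
  refine Subset.antisymm (fun y hy x hx => hy x (subset_closure hx)) fun y hy => ?_
  have hclosed : IsClosed {x : Euc d | ⟪x, y⟫ ≤ 0} := isClosed_le (by fun_prop) continuous_const
  exact fun x hx => closure_minimal hy hclosed hx

theorem IsSolidPointedCone.zero_mem (hC : IsSolidPointedCone C) : (0 : Euc d) ∈ C := by
  obtain ⟨x, hx⟩ := hC.interior_nonempty
  rw [← zero_smul ℝ x]
  exact hC.smul_mem x (interior_subset hx) 0 le_rfl

theorem dualCone_dualCone (hC : IsSolidPointedCone C) : dualCone (dualCone C) = C := by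
  refine Subset.antisymm (fun z hz => ?_) fun x hx y hy => (real_inner_comm x y).trans_le (hy x hx)
  by_contra hzC
  obtain ⟨f, a, hfa, haz⟩ := geometric_hahn_banach_closed_point hC.convex hC.isClosed hzC
  set y := (InnerProductSpace.toDual ℝ (Euc d)).symm f
  have hy : ∀ x, ⟪y, x⟫ = f x := fun x => InnerProductSpace.toDual_symm_apply
  have ha : 0 < a := by simpa only [map_zero] using hfa 0 hC.zero_mem
  have hyC : y ∈ dualCone C := fun x hx => by
    rw [real_inner_comm, hy]
    by_contra! hpos
    have := hfa _ (hC.smul_mem x hx (a / f x) (by positivity))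
    rw [map_smul, smul_eq_mul, div_mul_cancel₀ _ hpos.ne'] at this
    exact this.false
  exact (ha.trans haz).not_ge ((hy z).symm.trans_le (hz y hyC))

theorem neg_mem_interior_dualCone (hC : IsSolidPointedCone C) {w : Euc d} {ξ : ℝ} (hξ : 0 < ξ)
    (hw : ∀ x ∈ C, ‖x‖ = 1 → ξ < ⟪x, w⟫) : -w ∈ interior (dualCone C) := by
  refine mem_interior.2 ⟨Metric.ball (-w) ξ, fun y hy x hx => ?_, Metric.isOpen_ball,
    Metric.mem_ball_self hξ⟩
  rcases eq_or_ne x 0 with rfl | hx0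
  · rw [inner_zero_left]
  have hn : 0 < ‖x‖ := norm_pos_iff.2 hx0
  have hxw : ‖x‖ * ξ ≤ ⟪x, w⟫ := by
    have := hw (‖x‖⁻¹ • x) (hC.smul_mem x hx _ (by positivity)) (norm_smul_inv_norm hx0)
    rw [inner_smul_left, conj_trivial, inv_mul_eq_div, lt_div_iff₀' hn] at this
    exact this.le
  have hxy : ⟪x, y + w⟫ ≤ ‖x‖ * ξ := by
    rw [mem_ball_iff_norm, sub_neg_eq_add] at hy
    exact (real_inner_le_norm _ _).trans (by gcongr)
  rw [inner_add_right] at hxy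
  linarith

theorem closure_interior_dualCone (hS : (interior (dualCone S)).Nonempty) :
    closure (interior (dualCone S)) = dualCone S := by
  rw [(convex_dualCone S).closure_interior_eq_closure_of_nonempty_interior hS,
    (isClosed_dualCone S).closure_eq]

theorem dualCone_Omega (hC : IsSolidPointedCone C) (hne : (interior (dualCone C)).Nonempty) :
    dualCone (Omega C) = C := by
  refine Subset.antisymm (fun z hz => ?_) fun x hx v hv =>
    (real_inner_comm x v).trans_le (interior_subset hv.1 x hx)
  rw [← dualCone_dualCone hC, ← closure_interior_dualCone hne, dualCone_closure]
  intro y hy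
  rcases eq_or_ne y 0 with rfl | hy0
  · rw [inner_zero_left]
  have hn : 0 < ‖y‖⁻¹ := inv_pos.2 (norm_pos_iff.2 hy0)
  have hyΩ : ‖y‖⁻¹ • y ∈ Omega C :=
    ⟨smul_mem_interior_dualCone hy hn, mem_sphere_zero_iff_norm.2 (norm_smul_inv_norm hy0)⟩
  have := hz _ hyΩ
  rw [inner_smul_left, conj_trivial] at this
  exact nonpos_of_mul_nonpos_right this hn

theorem closure_Omega_subset : closure (Omega C) ⊆ dualCone C ∩ Metric.sphere 0 1 :=
  closure_minimal (inter_subset_inter_left _ interior_subset)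
    ((isClosed_dualCone C).inter Metric.isClosed_sphere)

theorem measurableSet_Omega (C : Set (Euc d)) : MeasurableSet (Omega C) :=
  isOpen_interior.measurableSet.inter Metric.isClosed_sphere.measurableSet

end DualCone

section WulffShape

variable {d : ℕ} {S : Set (Euc d)} {b : Euc d → ℝ}

/-- The Wulff shape of `b : S → ℝ`: the largest set whose support function is at most `b`
on `S`. The set `wulffSet` of the theorem is of this form. -/
def wulffShape (S : Set (Euc d)) (b : Euc d → ℝ) : Set (Euc d) :=
  {z | ∀ v ∈ S, ⟪z, v⟫ ≤ b v}

theorem isClosed_wulffShape : IsClosed (wulffShape S b) := by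
  simp only [wulffShape, ofPred_forall]
  exact isClosed_biInter fun v _ => isClosed_le (by fun_prop) continuous_const

theorem convex_wulffShape : Convex ℝ (wulffShape S b) := by
  intro x hx y hy s t hs ht hst v hv
  calc ⟪s • x + t • y, v⟫ = s * ⟪x, v⟫ + t * ⟪y, v⟫ := by
        rw [inner_add_left, real_inner_smul_left, real_inner_smul_left]
    _ ≤ s * b v + t * b v := by
        gcongr
        exacts [hx v hv, hy v hv]
    _ = b v := by rw [← add_mul, hst, one_mul]

theorem isPseudoCone_wulffShape (hne : (wulffShape S b).Nonempty) (hb : ∀ v ∈ S, b v ≤ 0) :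
    IsPseudoCone (wulffShape S b) where
  nonempty := hne
  isClosed := isClosed_wulffShape
  convex := convex_wulffShape
  smul_mem x hx r hr v hv := by
    have hxv : ⟪x, v⟫ ≤ 0 := (hx v hv).trans (hb v hv)
    rw [real_inner_smul_left]
    exact (mul_le_of_one_le_left hxv hr).trans (hx v hv)

theorem recCone_wulffShape (hne : (wulffShape S b).Nonempty) :
    recCone (wulffShape S b) = dualCone S := by
  obtain ⟨z, hz⟩ := hne
  ext y
  constructor
  · intro hy v hv
    rw [real_inner_comm]
    by_contra! hpos
    obtain ⟨r, hr, hr1⟩ := (((tendsto_id.atTop_mul_const hpos).eventually_gt_atTop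
      (b v - ⟪z, v⟫)).and (eventually_ge_atTop 1)).exists
    have := hy z hz r hr1 v hv
    rw [inner_add_left, real_inner_smul_left] at this
    rw [id] at hr
    linarith
  · intro hy x hx r hr v hv
    rw [inner_add_left, real_inner_smul_left, real_inner_comm v y]
    exact add_le_of_le_of_nonpos (hx v hv)
      (mul_nonpos_of_nonneg_of_nonpos (zero_le_one.trans hr) (hy v hv))

end WulffShape

section Domain

variable {m : ℕ} {C : Set (Euc (m + 1))} {e : OrthonormalBasis (Fin (m + 1)) ℝ (Euc (m + 1))}

theorem IsAxis.mem_interior_dualCone (he : IsAxis C (-e 0)) (hC : IsSolidPointedCone C) :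
    e 0 ∈ interior (dualCone C) := by
  obtain ⟨-, -, ξ, hξ, h, -⟩ := he
  simpa only [neg_neg] using neg_mem_interior_dualCone hC hξ h

theorem IsAxis.exists_lt_inner (he : IsAxis C (-e 0)) :
    ∃ ξ : ℝ, 0 < ξ ∧ ∀ v ∈ closure (Omega C), ξ < ⟪v, e 0⟫ := by
  obtain ⟨-, -, ξ, hξ, -, h⟩ := he
  refine ⟨ξ, hξ, fun v hv => ?_⟩
  have hv' := closure_Omega_subset hv
  have := h v hv'.1 (mem_sphere_zero_iff_norm.1 hv'.2)
  rwa [inner_neg_right, neg_lt_neg_iff] at this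

theorem IsAxis.inner_pos (he : IsAxis C (-e 0)) {v : Euc (m + 1)} (hv : v ∈ closure (Omega C)) :
    0 < ⟪v, e 0⟫ := by
  obtain ⟨ξ, hξ, h⟩ := he.exists_lt_inner
  exact hξ.trans (h v hv)

theorem IsAxis.Phi_PhiInv (he : IsAxis C (-e 0)) {v : Euc (m + 1)}
    (hv : v ∈ closure (Omega C)) : Phi e (PhiInv e v) = v :=
  PseudoCone.Phi_PhiInv e (mem_sphere_zero_iff_norm.1 (closure_Omega_subset hv).2)
    (he.inner_pos hv)

theorem isBounded_domain (he : IsAxis C (-e 0)) : Bornology.IsBounded (domain C e) := by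
  obtain ⟨ξ, hξ, h⟩ := he.exists_lt_inner
  refine isBounded_iff_forall_norm_le.2 ⟨ξ⁻¹, fun x hx => ?_⟩
  have hlt : ξ < (√(1 + ‖x‖ ^ 2))⁻¹ := inner_Phi_zero e x ▸ h _ (subset_closure hx)
  calc ‖x‖ ≤ √(1 + ‖x‖ ^ 2) := Real.le_sqrt_of_sq_le (by linarith)
    _ ≤ ξ⁻¹ := ((lt_inv_comm₀ hξ (sqrt_one_add_norm_sq_pos x)).1 hlt).le

theorem isCompact_closure_domain (he : IsAxis C (-e 0)) : IsCompact (closure (domain C e)) :=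
  (isBounded_domain he).isCompact_closure

theorem domain_nonempty (hC : IsSolidPointedCone C) (he : IsAxis C (-e 0)) :
    (domain C e).Nonempty := by
  refine ⟨0, ?_, mem_sphere_zero_iff_norm.2 (norm_Phi e 0)⟩
  rw [Phi_eq, pt_zero, one_smul]
  exact smul_mem_interior_dualCone (he.mem_interior_dualCone hC)
    (inv_pos.2 (sqrt_one_add_norm_sq_pos 0))

theorem Phi_image_domain (he : IsAxis C (-e 0)) : Phi e '' domain C e = Omega C :=
  image_preimage_eq_of_subset fun v hv => ⟨PhiInv e v, he.Phi_PhiInv (subset_closure hv)⟩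

theorem Phi_image_closure_domain (he : IsAxis C (-e 0)) :
    Phi e '' closure (domain C e) = closure (Omega C) := by
  rw [image_closure_of_isCompact (isCompact_closure_domain he) (continuous_Phi e).continuousOn,
    Phi_image_domain he]

end Domain

section WulffSet

variable {m : ℕ} {C : Set (Euc (m + 1))} {e : OrthonormalBasis (Fin (m + 1)) ℝ (Euc (m + 1))}
  {u : Euc m → ℝ}

theorem wulffSet_eq_wulffShape : wulffSet C e u =
    wulffShape (closure (Omega C)) fun v => ⟪v, e 0⟫ * u (PhiInv e v) := by
  simp only [wulffSet, wulffShape, ofPred_forall]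

theorem mem_wulffSet_iff (he : IsAxis C (-e 0)) {z : Euc (m + 1)} : z ∈ wulffSet C e u ↔
    ∀ x ∈ closure (domain C e), ⟪z, e 0⟫ + ⟪tail e z, x⟫ ≤ u x := by
  rw [wulffSet_eq_wulffShape, ← Phi_image_closure_domain he]
  refine forall_mem_image.trans (forall₂_congr fun x _ => ?_)
  simp only [inner_Phi, inner_Phi_zero, PhiInv_Phi]
  exact mul_le_mul_iff_right₀ (inv_pos.2 (sqrt_one_add_norm_sq_pos x))

theorem wulffSet_eq_hypograph (hC : IsSolidPointedCone C) (he : IsAxis C (-e 0))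
    (hu : ContinuousOn u (closure (domain C e))) :
    wulffSet C e u = {z | ⟪z, e 0⟫ ≤ -conjugate (closure (domain C e)) u (tail e z)} := by
  ext z
  rw [mem_wulffSet_iff he, mem_ofPred_eq, le_neg,
    conjugate_le_iff (isCompact_closure_domain he) (domain_nonempty hC he).closure hu]
  refine forall₂_congr fun x _ => ?_
  rw [sub_le_iff_le_add, neg_add_eq_sub, le_sub_iff_add_le, add_comm]

theorem frontier_hypograph {f : Euc m → ℝ} (hf : Continuous f) :
    frontier {z | ⟪z, e 0⟫ ≤ f (tail e z)} = {z | ⟪z, e 0⟫ = f (tail e z)} := by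
  refine Subset.antisymm (frontier_le_subset_eq (by fun_prop) (by fun_prop)) fun z hz =>
    ⟨subset_closure hz.le, fun hi => ?_⟩
  have hlim : Tendsto (fun ε : ℝ => z + pt e ε 0) (𝓝[>] 0) (𝓝 z) := by
    have hcont : Continuous fun ε : ℝ => z + pt e ε 0 := by
      simp only [pt_zero]
      fun_prop
    have := (hcont.tendsto 0).mono_left (nhdsWithin_le_nhds (s := Ioi 0))
    rwa [pt_zero, zero_smul, add_zero] at this
  obtain ⟨ε, hmem, hε⟩ := ((hlim.eventually (mem_interior_iff_mem_nhds.1 hi)).and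
    self_mem_nhdsWithin).exists
  have hle : ⟪z, e 0⟫ + ε ≤ f (tail e z) := by
    simpa only [mem_ofPred_eq, inner_add_left, map_add, inner_pt_zero, tail_pt, add_zero]
      using hmem
  exact (hle.trans_eq hz.symm).not_gt (lt_add_of_pos_right _ hε)

theorem frontier_wulffSet (hC : IsSolidPointedCone C) (he : IsAxis C (-e 0))
    (hu : ContinuousOn u (closure (domain C e))) : frontier (wulffSet C e u) =
      {z | ⟪z, e 0⟫ = -conjugate (closure (domain C e)) u (tail e z)} := by
  obtain ⟨L, hL⟩ := exists_lipschitzWith_conjugate (isCompact_closure_domain he)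
    (domain_nonempty hC he).closure hu
  rw [wulffSet_eq_hypograph hC he hu, frontier_hypograph (f := fun p => -conjugate _ u p)
    hL.continuous.neg]

theorem pt_mem_frontier_wulffSet (hC : IsSolidPointedCone C) (he : IsAxis C (-e 0))
    (hu : ContinuousOn u (closure (domain C e))) (p : Euc m) :
    pt e (-conjugate (closure (domain C e)) u p) p ∈ frontier (wulffSet C e u) := by
  rw [frontier_wulffSet hC he hu, mem_ofPred_eq, inner_pt_zero, tail_pt]

theorem pt_mem_wulffSet (hC : IsSolidPointedCone C) (he : IsAxis C (-e 0))
    (hu : ContinuousOn u (closure (domain C e))) (p : Euc m) :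
    pt e (-conjugate (closure (domain C e)) u p) p ∈ wulffSet C e u := by
  rw [wulffSet_eq_hypograph hC he hu, mem_ofPred_eq, inner_pt_zero, tail_pt]

theorem dualCone_closure_Omega (hC : IsSolidPointedCone C) (he : IsAxis C (-e 0)) :
    dualCone (closure (Omega C)) = C := by
  rw [dualCone_closure, dualCone_Omega hC ⟨_, he.mem_interior_dualCone hC⟩]

theorem wulffSet_zero (hC : IsSolidPointedCone C) (he : IsAxis C (-e 0)) :
    wulffSet C e 0 = C := by
  refine Eq.trans ?_ (dualCone_closure_Omega hC he)
  ext z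
  simp only [wulffSet, dualCone, mem_iInter, mem_ofPred_eq, Pi.zero_apply, mul_zero,
    real_inner_comm]

theorem isCPseudo_wulffSet (hC : IsSolidPointedCone C) (he : IsAxis C (-e 0))
    (hu : ContinuousOn u (closure (domain C e))) (hu0 : ∀ x ∈ closure (domain C e), u x ≤ 0) :
    IsCPseudo C (wulffSet C e u) := by
  have hne : (wulffSet C e u).Nonempty := ⟨_, pt_mem_wulffSet hC he hu 0⟩
  have hneg : ∀ v ∈ closure (Omega C), ⟪v, e 0⟫ * u (PhiInv e v) ≤ 0 := by
    rw [← Phi_image_closure_domain he]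
    rintro _ ⟨x, hx, rfl⟩
    rw [PhiInv_Phi, inner_Phi_zero]
    exact mul_nonpos_of_nonneg_of_nonpos (by positivity) (hu0 x hx)
  rw [wulffSet_eq_wulffShape] at hne ⊢
  exact ⟨isPseudoCone_wulffShape hne hneg,
    (recCone_wulffShape hne).trans (dualCone_closure_Omega hC he)⟩

theorem tendsto_tail_cobounded {f : Euc m → ℝ} (hf : Continuous f) :
    Tendsto (tail e) (Bornology.cobounded _ ⊓ 𝓟 {z | ⟪z, e 0⟫ = f (tail e z)})
      (Bornology.cobounded _) := by
  intro A hA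
  have hB : Bornology.IsBounded Aᶜ := Bornology.isBounded_compl_iff.2 hA
  have hgraph : Bornology.IsBounded ((fun p => pt e (f p) p) '' closure Aᶜ) := by
    refine (hB.isCompact_closure.image ?_).isBounded
    unfold pt
    fun_prop
  rw [mem_map, mem_inf_principal]
  filter_upwards [Bornology.isBounded_def.1 hgraph] with z hz hzf
  by_contra hzA
  exact hz ⟨tail e z, subset_closure hzA, by simp only [← hzf, pt_tail]⟩

theorem infDist_frontier_le (hC : IsSolidPointedCone C) (he : IsAxis C (-e 0))
    (hu : ContinuousOn u (closure (domain C e))) {z : Euc (m + 1)}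
    (hz : z ∈ frontier (wulffSet C e u)) : Metric.infDist z (frontier C) ≤
      |conjugate (closure (domain C e)) u (tail e z) -
        conjugate (closure (domain C e)) 0 (tail e z)| := by
  set p := tail e z with hp
  have hzp : z = pt e (-conjugate (closure (domain C e)) u p) p := by
    rw [frontier_wulffSet hC he hu] at hz
    rw [hp, ← hz, pt_tail]
  have hw : pt e (-conjugate (closure (domain C e)) 0 p) p ∈ frontier C := by
    have := pt_mem_frontier_wulffSet (u := 0) hC he continuousOn_const p
    rwa [wulffSet_zero hC he] at this
  refine (Metric.infDist_le_dist_of_mem hw).trans_eq ?_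
  rw [hzp, dist_eq_norm, pt, pt, add_sub_add_right_eq_sub, ← sub_smul, norm_smul, e.norm_eq_one,
    mul_one, Real.norm_eq_abs, ← abs_neg]
  congr 1
  ring

theorem tendsto_infDist_frontier_wulffSet (hC : IsSolidPointedCone C) (he : IsAxis C (-e 0))
    (hu : ContinuousOn u (closure (domain C e))) (hu0 : ∀ x ∈ closure (domain C e), u x ≤ 0)
    (h0 : ∀ x ∈ frontier (domain C e), u x = 0) :
    Tendsto (fun x : Euc (m + 1) => Metric.infDist x (frontier C))
      (Bornology.cobounded (Euc (m + 1)) ⊓ 𝓟 (frontier (wulffSet C e u))) (𝓝 0) := by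
  obtain ⟨L, hL⟩ := exists_lipschitzWith_conjugate (isCompact_closure_domain he)
    (domain_nonempty hC he).closure hu
  have htail : Tendsto (tail e) (Bornology.cobounded _ ⊓ 𝓟 (frontier (wulffSet C e u)))
      (Bornology.cobounded _) := by
    rw [frontier_wulffSet hC he hu]
    exact tendsto_tail_cobounded (f := fun p => -conjugate _ u p) hL.continuous.neg
  have hlim := ((tendsto_conjugate_sub_conjugate_zero (isCompact_closure_domain he)
    (domain_nonempty hC he) hu hu0 h0).comp htail).abs
  rw [abs_zero] at hlim
  refine squeeze_zero' (.of_forall fun _ => Metric.infDist_nonneg) ?_ hlim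
  filter_upwards [mem_inf_of_right (mem_principal_self _)] with z hz
  exact infDist_frontier_le hC he hu hz

end WulffSet

section MongeAmpere

variable {m : ℕ} {D : Set (Euc m)} {u : Euc m → ℝ} {Ξ : Set (Euc m)}

theorem measurable_gradient (f : Euc m → ℝ) : Measurable (gradient f) :=
  (InnerProductSpace.toDual ℝ (Euc m)).symm.continuous.measurable.comp (measurable_fderiv ℝ f)

theorem gradient_conjugate_mem_iff (hD : IsCompact (closure D)) (hne : D.Nonempty)
    (hu : ContinuousOn u (closure D)) (hΞ : Ξ ⊆ D) {p : Euc m}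
    (hp : DifferentiableAt ℝ (conjugate (closure D) u) p) :
    gradient (conjugate (closure D) u) p ∈ Ξ ↔ p ∈ ⋃ x ∈ Ξ, subdiff D u x := by
  rw [mem_iUnion₂]
  constructor
  · intro hpΞ
    obtain ⟨x, hx, hpx⟩ := exists_conjugate_eq hD hne.closure hu p
    rw [gradient_conjugate_eq hD hu hx hpx hp] at hpΞ
    exact ⟨x, hpΞ, (mem_subdiff_iff hD hu (hΞ hpΞ)).2 hpx⟩
  · rintro ⟨x, hx, hpx⟩
    rw [mem_subdiff_iff hD hu (hΞ hx)] at hpx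
    rwa [gradient_conjugate_eq hD hu (subset_closure (hΞ hx)) hpx hp]

theorem iUnion_subdiff_ae_eq (hD : IsCompact (closure D)) (hne : D.Nonempty)
    (hu : ContinuousOn u (closure D)) (hΞ : Ξ ⊆ D) :
    (⋃ x ∈ Ξ, subdiff D u x : Set (Euc m)) =ᵐ[volume]
      gradient (conjugate (closure D) u) ⁻¹' Ξ := by
  obtain ⟨L, hL⟩ := exists_lipschitzWith_conjugate hD hne.closure hu
  filter_upwards [hL.ae_differentiableAt] with p hp
  exact propext (gradient_conjugate_mem_iff hD hne hu hΞ hp).symm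

theorem mongeAmpere_eq_map_gradient (hD : IsCompact (closure D)) (hne : D.Nonempty)
    (hu : ContinuousOn u (closure D)) (hΞm : MeasurableSet Ξ) (hΞ : Ξ ⊆ D) :
    mongeAmpere D u Ξ = volume.map (gradient (conjugate (closure D) u)) Ξ := by
  rw [mongeAmpere, EuclideanSpace.euclideanHausdorffMeasure_eq_volume,
    measure_congr (iUnion_subdiff_ae_eq hD hne hu hΞ),
    Measure.map_apply (measurable_gradient _) hΞm]

end MongeAmpere

section Transport

variable {m : ℕ} {C : Set (Euc (m + 1))} {e : OrthonormalBasis (Fin (m + 1)) ℝ (Euc (m + 1))}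
  {μ : Measure (Omega C)} {Ξ : Set (Euc m)}

variable (e μ) in
/-- The set function `transported e μ` of the theorem, as a measure on `ℝ^m`. -/
def transportedMeasure : Measure (Euc m) :=
  (μ.withDensity fun v => ENNReal.ofReal |⟪(v : Euc (m + 1)), e 0⟫|).map
    fun v : Omega C => PhiInv e v

theorem measurable_PhiInv : Measurable fun v : Omega C => PhiInv e v := by
  have h : Measurable (PhiInv e) := by
    have h0 : Measurable fun v : Euc (m + 1) => ⟪v, e 0⟫ := Continuous.measurable (by fun_prop)
    rw [funext (PhiInv_eq e)]
    exact h0.inv.smul (tail e).continuous.measurable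
  exact h.comp measurable_subtype_coe

theorem setOf_mem_Phi_image (he : IsAxis C (-e 0)) (Ξ : Set (Euc m)) :
    {v : Omega C | (v : Euc (m + 1)) ∈ Phi e '' Ξ} =
      (fun v : Omega C => PhiInv e v) ⁻¹' Ξ := by
  ext v
  refine ⟨?_, fun h => ⟨_, h, he.Phi_PhiInv (subset_closure v.2)⟩⟩
  rintro ⟨x, hx, hxv⟩
  rwa [mem_preimage, ← hxv, PhiInv_Phi]

theorem transportedMeasure_apply (he : IsAxis C (-e 0)) (hΞ : MeasurableSet Ξ) :
    transportedMeasure e μ Ξ = transported e μ Ξ := by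
  rw [transportedMeasure, Measure.map_apply measurable_PhiInv hΞ,
    withDensity_apply _ (measurable_PhiInv hΞ), transported, setOf_mem_Phi_image he]

theorem setLIntegral_transportedMeasure (he : IsAxis C (-e 0)) (hΞ : MeasurableSet Ξ) :
    ∫⁻ x in Ξ, ENNReal.ofReal √(1 + ‖x‖ ^ 2) ∂transportedMeasure e μ =
      μ {v | (v : Euc (m + 1)) ∈ Phi e '' Ξ} := by
  have hcancel : ∀ v : Omega C, ENNReal.ofReal |⟪(v : Euc (m + 1)), e 0⟫| *
      ENNReal.ofReal √(1 + ‖PhiInv e v‖ ^ 2) = 1 := fun v => by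
    have hinner := inner_Phi_zero e (PhiInv e v)
    rw [he.Phi_PhiInv (subset_closure v.2)] at hinner
    rw [← ENNReal.ofReal_mul (abs_nonneg _), hinner,
      abs_of_pos (inv_pos.2 (sqrt_one_add_norm_sq_pos _)),
      inv_mul_cancel₀ (sqrt_one_add_norm_sq_pos _).ne', ENNReal.ofReal_one]
  have hm : Measurable fun v : Omega C => ENNReal.ofReal |⟪(v : Euc (m + 1)), e 0⟫| :=
    (Continuous.measurable (by fun_prop)).ennreal_ofReal
  have hg : Measurable fun x : Euc m => ENNReal.ofReal √(1 + ‖x‖ ^ 2) :=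
    (Continuous.measurable (by fun_prop)).ennreal_ofReal
  rw [transportedMeasure, setLIntegral_map hΞ hg measurable_PhiInv, setOf_mem_Phi_image he,
    ← setLIntegral_one]
  exact (setLIntegral_withDensity_eq_setLIntegral_mul _ hm (hg.comp measurable_PhiInv)
    (measurable_PhiInv hΞ)).trans (lintegral_congr hcancel)

end Transport

section SurfaceArea

variable {m : ℕ} {C : Set (Euc (m + 1))} {e : OrthonormalBasis (Fin (m + 1)) ℝ (Euc (m + 1))}
  {u : Euc m → ℝ} {Ξ : Set (Euc m)}

theorem supportFn_wulffSet_Phi (hC : IsSolidPointedCone C) (he : IsAxis C (-e 0))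
    (hu : ContinuousOn u (closure (domain C e))) (hc : ConvexOn ℝ (closure (domain C e)) u)
    {x : Euc m} (hx : x ∈ closure (domain C e)) :
    supportFn (wulffSet C e u) (Phi e x) = (√(1 + ‖x‖ ^ 2))⁻¹ * u x := by
  have hub : (√(1 + ‖x‖ ^ 2))⁻¹ * u x ∈
      upperBounds ((fun z => ⟪z, Phi e x⟫) '' wulffSet C e u) := by
    rintro _ ⟨z, hz, rfl⟩
    simp only [inner_Phi]
    gcongr
    exact (mem_wulffSet_iff he).1 hz x hx
  refine le_antisymm (csSup_le ⟨_, mem_image_of_mem _ (pt_mem_wulffSet hC he hu 0)⟩ hub) ?_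
  refine le_of_forall_lt_imp_le_of_dense fun a ha => ?_
  obtain ⟨p, hp⟩ := exists_le_inner_sub_conjugate (isCompact_closure_domain he) hu hc hx
    ((lt_inv_mul_iff₀ (sqrt_one_add_norm_sq_pos x)).1 ha)
  refine le_trans ?_ (le_csSup ⟨_, hub⟩ (mem_image_of_mem _ (pt_mem_wulffSet hC he hu p)))
  simp only [inner_Phi, inner_pt_zero, tail_pt]
  rw [le_inv_mul_iff₀ (sqrt_one_add_norm_sq_pos x)]
  linarith

theorem inner_pt_eq_supportFn_iff (hC : IsSolidPointedCone C) (he : IsAxis C (-e 0))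
    (hu : ContinuousOn u (closure (domain C e))) (hc : ConvexOn ℝ (closure (domain C e)) u)
    {x : Euc m} (hx : x ∈ domain C e) (p : Euc m) :
    ⟪pt e (-conjugate (closure (domain C e)) u p) p, Phi e x⟫ =
      supportFn (wulffSet C e u) (Phi e x) ↔ p ∈ subdiff (domain C e) u x := by
  rw [supportFn_wulffSet_Phi hC he hu hc (subset_closure hx), inner_Phi, inner_pt_zero, tail_pt,
    mem_subdiff_iff (isCompact_closure_domain he) hu hx,
    mul_right_inj' (inv_pos.2 (sqrt_one_add_norm_sq_pos x)).ne']
  constructor <;> intro h <;> linarith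

theorem invGauss_wulffSet (hC : IsSolidPointedCone C) (he : IsAxis C (-e 0))
    (hu : ContinuousOn u (closure (domain C e))) (hc : ConvexOn ℝ (closure (domain C e)) u)
    (hΞ : Ξ ⊆ domain C e) : invGauss (wulffSet C e u) (Phi e '' Ξ) =
      (fun p => pt e (-conjugate (closure (domain C e)) u p) p) ''
        ⋃ x ∈ Ξ, subdiff (domain C e) u x := by
  have key : ∀ x ∈ Ξ, ∀ p, _ := fun x hx p => inner_pt_eq_supportFn_iff hC he hu hc (hΞ hx) p
  ext z
  constructor
  · rintro ⟨hz, _, ⟨x, hx, rfl⟩, hzx⟩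
    have hz' : pt e (-conjugate (closure (domain C e)) u (tail e z)) (tail e z) = z := by
      rw [frontier_wulffSet hC he hu] at hz
      rw [← hz, pt_tail]
    exact ⟨tail e z, mem_iUnion₂.2 ⟨x, hx, (key x hx _).1 (by rw [hz', hzx])⟩, hz'⟩
  · rintro ⟨p, hp, rfl⟩
    obtain ⟨x, hx, hpx⟩ := mem_iUnion₂.1 hp
    exact ⟨pt_mem_frontier_wulffSet hC he hu p, _, ⟨x, hx, rfl⟩, (key x hx p).2 hpx⟩

theorem euclideanHausdorffMeasure_invGauss_wulffSet (hC : IsSolidPointedCone C)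
    (he : IsAxis C (-e 0)) (hu : ContinuousOn u (closure (domain C e)))
    (hc : ConvexOn ℝ (closure (domain C e)) u) (hΞm : MeasurableSet Ξ) (hΞ : Ξ ⊆ domain C e) :
    μHE[m] (invGauss (wulffSet C e u) (Phi e '' Ξ)) =
      ∫⁻ x in Ξ, ENNReal.ofReal √(1 + ‖x‖ ^ 2)
        ∂volume.map (gradient (conjugate (closure (domain C e)) u)) := by
  have hD := isCompact_closure_domain he
  have hne := domain_nonempty hC he
  obtain ⟨L, hL⟩ := exists_lipschitzWith_conjugate hD hne.closure hu
  have harea := euclideanHausdorffMeasure_graph (w := -e 0) (J := horizontal e)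
    ((norm_neg _).trans (e.norm_eq_one 0))
    (fun x => by rw [inner_neg_right, inner_horizontal_zero, neg_zero]) hL
    (⋃ x ∈ Ξ, subdiff (domain C e) u x)
  simp only [finrank_euclideanSpace_fin, smul_neg, ← neg_smul] at harea
  rw [invGauss_wulffSet hC he hu hc hΞ]
  refine harea.trans ?_
  rw [setLIntegral_congr (iUnion_subdiff_ae_eq hD hne hu hΞ),
    setLIntegral_map hΞm (Continuous.measurable (by fun_prop)).ennreal_ofReal
      (measurable_gradient _)]

theorem surfaceArea_wulffSet (hC : IsSolidPointedCone C) (he : IsAxis C (-e 0))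
    {μ : Measure (Omega C)} (hu : ContinuousOn u (closure (domain C e)))
    (hc : ConvexOn ℝ (closure (domain C e)) u)
    (hM : ∀ Ξ : Set (Euc m), MeasurableSet Ξ → Ξ ⊆ domain C e →
      mongeAmpere (domain C e) u Ξ = transported e μ Ξ) {η : Set (Omega C)}
    (hη : MeasurableSet η) : surfaceArea C (wulffSet C e u) η = μ η := by
  set Ξ : Set (Euc m) := Phi e ⁻¹' (Subtype.val '' η)
  have hΞm : MeasurableSet Ξ :=
    (continuous_Phi e).measurable ((measurableSet_Omega C).subtype_image hη)
  have hΞ : Ξ ⊆ domain C e := preimage_mono (Subtype.coe_image_subset _ _)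
  have hΞη : Phi e '' Ξ = Subtype.val '' η := by
    refine image_preimage_eq_of_subset ((Subtype.coe_image_subset _ _).trans ?_)
    exact (Phi_image_domain he).ge.trans (image_subset_range _ _)
  have hmeas : (volume.map (gradient (conjugate (closure (domain C e)) u))).restrict Ξ =
      (transportedMeasure e μ).restrict Ξ := by
    ext A hA
    rw [Measure.restrict_apply hA, Measure.restrict_apply hA,
      transportedMeasure_apply he (hA.inter hΞm),
      ← hM _ (hA.inter hΞm) (inter_subset_right.trans hΞ),
      mongeAmpere_eq_map_gradient (isCompact_closure_domain he) (domain_nonempty hC he) hu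
        (hA.inter hΞm) (inter_subset_right.trans hΞ)]
  rw [surfaceArea, ← hΞη, euclideanHausdorffMeasure_invGauss_wulffSet hC he hu hc hΞm hΞ, hmeas,
    setLIntegral_transportedMeasure he hΞm, hΞη]
  simp only [Subtype.val_injective.mem_set_image, ofPred_mem_eq]

end SurfaceArea

end PseudoCone

end

theorem theorem3p3 (m : ℕ) (hm : 1 ≤ m)
    (C : Set (PseudoCone.Euc (m + 1))) (hC : PseudoCone.IsSolidPointedCone C)
    (e : OrthonormalBasis (Fin (m + 1)) ℝ (PseudoCone.Euc (m + 1)))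
    (he : PseudoCone.IsAxis C (-e 0))
    (μ : Measure (PseudoCone.Omega C)) (hμ : IsLocallyFiniteMeasure μ)
    (u : PseudoCone.Euc m → ℝ)
    (hu_cont : ContinuousOn u (closure (PseudoCone.domain C e)))
    (hu_conv : ConvexOn ℝ (closure (PseudoCone.domain C e)) u)
    (hu_eq : ∀ Ξ : Set (PseudoCone.Euc m), MeasurableSet Ξ → Ξ ⊆ PseudoCone.domain C e →
      PseudoCone.mongeAmpere (PseudoCone.domain C e) u Ξ = PseudoCone.transported e μ Ξ)
    (hu_bdry : ∀ x ∈ frontier (PseudoCone.domain C e), u x = 0) :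
    PseudoCone.IsCAsymptotic C (PseudoCone.wulffSet C e u) ∧
      ∀ η : Set (PseudoCone.Omega C), MeasurableSet η →
        PseudoCone.surfaceArea C (PseudoCone.wulffSet C e u) η = μ η := by
  have : Nonempty (Fin m) := ⟨⟨0, hm⟩⟩
  have hu_nonpos : ∀ x ∈ closure (PseudoCone.domain C e), u x ≤ 0 := fun x hx =>
    PseudoCone.nonpos_of_frontier_eq_zero (PseudoCone.isBounded_domain he) hu_conv hu_bdry hx
  exact ⟨⟨PseudoCone.isCPseudo_wulffSet hC he hu_cont hu_nonpos,
    PseudoCone.tendsto_infDist_frontier_wulffSet hC he hu_cont hu_nonpos hu_bdry⟩,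
    fun η hη => PseudoCone.surfaceArea_wulffSet hC he hu_cont hu_conv hu_eq hη⟩
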